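/- Let $n, k, \ell, m \ge 0$ be integers. For a permutation $\sigma$ of $[n]=\{1,\dots,n\}$: - a weak exceedance of $\sigma$ is an index $j\in[n]$ with $\sigma(j)\ge j$; - the number of crossings of $\sigma$ is the number of pairs $(i,j)\in[n]^2$ with $j<i\le\sigma(j)<\sigma(i)$ plus the number of pairs $(i,j)\in[n]^2$ with $j>i>\sigma(j)>\sigma(i)$; - the number of nestings of $\sigma$ is the number of pairs $(i,j)\in[n]^2$ with $j<i\le\sigma(i)<\sigma(j)$ plus the number of pairs $(i,j)\in[n]^2$ with $j>i>\sigma(i)>\sigma(j)$; - a descent of $\sigma$ is an index $i$ with $1\le i<n$ and $\sigma(i)>\sigma(i+1)$; - an occurrence of the pattern $31\text{-}2$ in $\sigma$ is a pair $i<j$ in $[n]$ with $\sigma(i)>\sigma(j)>\sigma(i+1)$; - an occurrence of the pattern $2\text{-}31$ in $\sigma$ is a pair $i<j$ in $[n]$ with $j<n$ and $\sigma(j+1)<\sigma(i)<\sigma(j)$. Then the number of permutations of $[n]$ with exactly $k$ weak exceedances, $\ell$ crossings and $m$ nestings equals the number of permutations of $[n]$ with exactly $n-k$ descents, $\ell$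 occurrences of the pattern $31\text{-}2$ and $m$ occurrences of the pattern $2\text{-}31$. -/

import Mathlib

namespace PermStat

/-- The number of weak exceedances of `σ`: positions `j` with `σ(j) ≥ j`.
A permutation of `[n]` is modelled as a permutation of `Fin n`; all the statistics below only
compare positions and values, so the shift of indices from `1, …, n` to `0, …, n - 1` does not
change them. -/
def weakExceedances {n : ℕ} (σ : Equiv.Perm (Fin n)) : ℕ :=
  (Finset.univ.filter fun j : Fin n => j ≤ σ j).card

/-- `C₊(i) = {j | j < i ≤ σ(j) < σ(i)}`. -/
def crossPlus {n : ℕ} (σ : Equiv.Perm (Fin n)) (i : Fin n) : Finset (Fin n) :=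
  Finset.univ.filter fun j => j < i ∧ i ≤ σ j ∧ σ j < σ i

/-- `C₋(i) = {j | j > i > σ(j) > σ(i)}`. -/
def crossMinus {n : ℕ} (σ : Equiv.Perm (Fin n)) (i : Fin n) : Finset (Fin n) :=
  Finset.univ.filter fun j => i < j ∧ σ j < i ∧ σ i < σ j

/-- The number of crossings of `σ`. -/
def crossings {n : ℕ} (σ : Equiv.Perm (Fin n)) : ℕ :=
  ∑ i, (crossPlus σ i).card + ∑ i, (crossMinus σ i).card

/-- `A₊(i) = {j | j < i ≤ σ(i) < σ(j)}`. -/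
def nestPlus {n : ℕ} (σ : Equiv.Perm (Fin n)) (i : Fin n) : Finset (Fin n) :=
  Finset.univ.filter fun j => j < i ∧ i ≤ σ i ∧ σ i < σ j

/-- `A₋(i) = {j | j > i > σ(i) > σ(j)}`. -/
def nestMinus {n : ℕ} (σ : Equiv.Perm (Fin n)) (i : Fin n) : Finset (Fin n) :=
  Finset.univ.filter fun j => i < j ∧ σ i < i ∧ σ j < σ i

/-- The number of nestings of `σ`. -/
def nestings {n : ℕ} (σ : Equiv.Perm (Fin n)) : ℕ :=
  ∑ i, (nestPlus σ i).card + ∑ i, (nestMinus σ i).card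

/-- The number of descents of `σ`: positions `i` such that `i + 1` is also a position and
`σ(i) > σ(i + 1)`. -/
def descents {n : ℕ} (σ : Equiv.Perm (Fin n)) : ℕ :=
  (Finset.univ.filter fun i : Fin n => ∃ h : (i : ℕ) + 1 < n, σ ⟨i + 1, h⟩ < σ i).card

/-- The number of occurrences of the pattern `31-2` in `σ`: pairs of positions `i < j` such that
`σ(i) > σ(j) > σ(i + 1)`. -/
def occ31_2 {n : ℕ} (σ : Equiv.Perm (Fin n)) : ℕ :=
  (Finset.univ.filter fun p : Fin n × Fin n => p.1 < p.2 ∧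
    ∃ h : (p.1 : ℕ) + 1 < n, σ p.2 < σ p.1 ∧ σ ⟨p.1 + 1, h⟩ < σ p.2).card

/-- The number of occurrences of the pattern `2-31` in `σ`: pairs of positions `i < j` such that
`j + 1` is also a position and `σ(j + 1) < σ(i) < σ(j)`. -/
def occ2_31 {n : ℕ} (σ : Equiv.Perm (Fin n)) : ℕ :=
  (Finset.univ.filter fun p : Fin n × Fin n => p.1 < p.2 ∧
    ∃ h : (p.2 : ℕ) + 1 < n, σ ⟨p.2 + 1, h⟩ < σ p.1 ∧ σ p.1 < σ p.2).card

end PermStat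

/-! Both triples of statistics are read off codes of permutations by the same objects, Laguerre
histories: Motzkin paths whose steps carry two labels with prescribed sum. The Foata–Zeilberger code
`crossingCode` stores crossings and nestings in the labels, and its first bits mark the weak
exceedances. The Françon–Viennot code `patternCode` stores the occurrences of `31-2` and `2-31`, and
its first bits mark the letters that are not descent tops. Each side therefore counts the histories
of length `n` with first bits summing to `k` and labels summing to `ℓ` and `m`.

No inverse map is constructed. Both codes are injective (`crossingCode_injective`,
`patternCode_injective`), and there are at most `n!` histories (`card_histories_le`), so both are
bijections (`card_filter_stepList`). -/

namespace PermStat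

open Finset

section Counting

variable {α : Type*} [Fintype α]

theorem card_filter_eq_add_ite [DecidableEq α] {p q : α → Prop} [DecidablePred p]
    [DecidablePred q] {b : Prop} [Decidable b] (a : α) (hpq : ∀ j, j ≠ a → (p j ↔ q j))
    (hq : ¬ q a) (hp : p a ↔ b) :
    (univ.filter p).card = (univ.filter q).card + if b then 1 else 0 := by
  by_cases hb : b
  · have : univ.filter p = insert a (univ.filter q) := by
      ext j
      by_cases hj : j = a
      · subst hj; simp [hp, hb]
      · simp [hj, hpq j hj]
    rw [this, card_insert_of_notMem (by simpa using hq), if_pos hb]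
  · have : univ.filter p = univ.filter q := by
      ext j
      by_cases hj : j = a
      · subst hj; simp [hp, hb, hq]
      · simp [hpq j hj]
    rw [this, if_neg hb, add_zero]

theorem card_filter_eq_add {p q r : α → Prop} [DecidablePred p]
    [DecidablePred q] [DecidablePred r] (hp : ∀ j, p j ↔ q j ∨ r j) (hd : ∀ j, q j → ¬ r j) :
    (univ.filter p).card = (univ.filter q).card + (univ.filter r).card := by
  classical
  rw [← card_union_of_disjoint, ← filter_or]
  · congr 1; ext j; simp [hp]
  · exact disjoint_filter.2 fun j _ => hd j

end Counting

/-! ### Laguerre histories and the bound `n!` on their number. -/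

section Histories

/-- One step of a Laguerre history: two bits, which give the step of the underlying Motzkin path,
and two labels whose sum is prescribed by the height and the first bit. -/
abbrev Step := Bool × Bool × ℕ × ℕ

/-- The label pairs with sum `s`, decorated with the given bits and put in front of the histories
in `T`. -/
def extend (E F : Bool) (s : ℕ) (T : Finset (List Step)) : Finset (List Step) :=
  (antidiagonal s ×ˢ T).image fun x => (E, F, x.1.1, x.1.2) :: x.2

theorem card_extend_le (E F : Bool) (s : ℕ) (T : Finset (List Step)) :
    (extend E F s T).card ≤ (s + 1) * T.card :=
  card_image_le.trans (by simp)

theorem cons_mem_extend {E F : Bool} {s c d : ℕ} {T : Finset (List Step)} {l : List Step}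
    (h : c + d = s) (hl : l ∈ T) : (E, F, c, d) :: l ∈ extend E F s T :=
  mem_image.2 ⟨((c, d), l), by simp [h, hl], rfl⟩

/-- The Laguerre histories of length `v` that end at height `h`, last step first. -/
def histories : ℕ → ℕ → Finset (List Step)
  | 0, 0 => {[]}
  | 0, _ + 1 => ∅
  | v + 1, 0 => extend true true 0 (histories v 0) ∪ extend false true 0 (histories v 1)
  | v + 1, h + 1 =>
    (extend true false h (histories v h) ∪ extend true true (h + 1) (histories v (h + 1))) ∪
      (extend false false h (histories v (h + 1)) ∪
        extend false true (h + 1) (histories v (h + 2)))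

/-- A label pair with sum `s` can be chosen in `s + 1` ways. The resulting recursion is solved by
`v! * v.choose h`; general end heights are needed for the induction, only `h = 0` afterwards. -/
theorem card_histories_le (v h : ℕ) : (histories v h).card ≤ v.factorial * v.choose h := by
  induction v generalizing h with
  | zero => cases h <;> simp [histories]
  | succ v ih =>
    cases h with
    | zero =>
      have h1 := card_extend_le true true 0 (histories v 0)
      have h2 := card_extend_le false true 0 (histories v 1)
      have h3 := card_union_le (extend true true 0 (histories v 0))
        (extend false true 0 (histories v 1))
      have h4 := ih 0
      have h5 := ih 1
      simp only [histories, Nat.choose_zero_right, Nat.choose_one_right, Nat.factorial_succ] at *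
      nlinarith
    | succ h =>
      have h1 := card_extend_le true false h (histories v h)
      have h2 := card_extend_le true true (h + 1) (histories v (h + 1))
      have h3 := card_extend_le false false h (histories v (h + 1))
      have h4 := card_extend_le false true (h + 1) (histories v (h + 2))
      have h5 := card_union_le (extend true false h (histories v h))
        (extend true true (h + 1) (histories v (h + 1)))
      have h6 := card_union_le (extend false false h (histories v (h + 1)))
        (extend false true (h + 1) (histories v (h + 2)))
      have h7 := card_union_le
        (extend true false h (histories v h) ∪ extend true true (h + 1) (histories v (h + 1)))
        (extend false false h (histories v (h + 1)) ∪
          extend false true (h + 1) (histories v (h + 2)))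
      have i1 := Nat.mul_le_mul_left (h + 1) (ih h)
      have i2 := Nat.mul_le_mul_left (2 * h + 3) (ih (h + 1))
      have i3 := Nat.mul_le_mul_left (h + 2) (ih (h + 2))
      -- Pascal's rule and two absorption identities; `2 * h + 3 = (h + 2) + (h + 1)` comes from the
      -- two kinds of level step.
      have key : (h + 1) * v.choose h + (2 * h + 3) * v.choose (h + 1)
          + (h + 2) * v.choose (h + 2) = (v + 1) * (v + 1).choose (h + 1) := by
        have e1 := Nat.add_one_mul_choose_eq v h
        have e2 := Nat.add_one_mul_choose_eq v (h + 1)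
        rw [Nat.choose_succ_succ] at e1 e2
        rw [Nat.choose_succ_succ]
        linarith
      have key' := congrArg (v.factorial * ·) key
      simp only [histories, Nat.factorial_succ] at *
      linarith

/-- The list of the first `v` terms of `e`, in reverse order. -/
def prefixList (e : ℕ → Step) : ℕ → List Step
  | 0 => []
  | v + 1 => e v :: prefixList e v

theorem prefixList_mem_histories {e : ℕ → Step} {ht : ℕ → ℕ} {n : ℕ} (h0 : ht 0 = 0)
    (hlabel : ∀ i < n, (e i).2.2.1 + (e i).2.2.2 + (!(e i).1).toNat = ht i)
    (hstep : ∀ i < n, ht (i + 1) + (e i).2.1.toNat = ht i + (e i).1.toNat) :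
    ∀ v ≤ n, prefixList e v ∈ histories v (ht v) := by
  intro v
  induction v with
  | zero => simp [h0, prefixList, histories]
  | succ v ih =>
    intro hv
    have ih := ih (by omega)
    have hl := hlabel v hv
    have hs := hstep v hv
    rw [prefixList]
    rcases he : e v with ⟨E, F, c, d⟩
    rw [he] at hl hs
    generalize ht v = x at *
    generalize ht (v + 1) = y at *
    cases E <;> cases F <;> simp only [Bool.not_false, Bool.not_true, Bool.toNat_true,
      Bool.toNat_false] at hl hs <;> rcases y with _ | y
    · omega
    · obtain rfl : x = y + 1 := by omega
      simp only [histories, mem_union]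
      exact .inr (.inl (cons_mem_extend (by omega) ih))
    · obtain rfl : x = 1 := by omega
      simp only [histories, mem_union]
      exact .inr (cons_mem_extend (by omega) ih)
    · obtain rfl : x = y + 2 := by omega
      simp only [histories, mem_union]
      exact .inr (.inr (cons_mem_extend (by omega) ih))
    · omega
    · obtain rfl : x = y := by omega
      simp only [histories, mem_union]
      exact .inl (.inl (cons_mem_extend (by omega) ih))
    · obtain rfl : x = 0 := by omega
      simp only [histories, mem_union]
      exact .inl (cons_mem_extend (by omega) ih)
    · obtain rfl : x = y + 1 := by omega
      simp only [histories, mem_union]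
      exact .inl (.inr (cons_mem_extend (by omega) ih))

theorem prefixList_inj {e e' : ℕ → Step} {v : ℕ} (h : prefixList e v = prefixList e' v) :
    ∀ i < v, e i = e' i := by
  induction v with
  | zero => simp
  | succ v ih =>
    rw [prefixList, prefixList, List.cons.injEq] at h
    intro i hi
    rcases Nat.lt_succ_iff_lt_or_eq.1 hi with hi | rfl
    · exact ih h.2 i hi
    · exact h.1

theorem sum_map_prefixList (e : ℕ → Step) (g : Step → ℕ) (v : ℕ) :
    ((prefixList e v).map g).sum = ∑ i ∈ range v, g (e i) := by
  induction v with
  | zero => simp [prefixList]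
  | succ v ih => rw [prefixList, List.map_cons, List.sum_cons, ih, sum_range_succ, add_comm]

/-- A sequence of steps indexed by `Fin n`, as a list in reverse order. -/
def stepList {n : ℕ} (e : Fin n → Step) : List Step :=
  prefixList (fun i => if h : i < n then e ⟨i, h⟩ else (false, false, 0, 0)) n

theorem stepList_injective {n : ℕ} : Function.Injective (stepList (n := n)) := by
  intro e e' h
  funext i
  simpa using prefixList_inj h i i.2

theorem sum_map_stepList {n : ℕ} (e : Fin n → Step) (g : Step → ℕ) :
    ((stepList e).map g).sum = ∑ i, g (e i) := by
  rw [stepList, sum_map_prefixList, sum_range]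
  simp

theorem stepList_mem_histories {n : ℕ} {e : Fin n → Step} {ht : ℕ → ℕ} (h0 : ht 0 = 0)
    (hn : ht n = 0)
    (hlabel : ∀ i : Fin n, (e i).2.2.1 + (e i).2.2.2 + (!(e i).1).toNat = ht i)
    (hstep : ∀ i : Fin n, ht (i + 1) + (e i).2.1.toNat = ht i + (e i).1.toNat) :
    stepList e ∈ histories n 0 := by
  rw [← hn]
  refine prefixList_mem_histories h0 ?_ ?_ n le_rfl <;> intro i hi <;> simp only [hi, dif_pos]
  · exact hlabel ⟨i, hi⟩
  · exact hstep ⟨i, hi⟩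

/-- An injective encoding of permutations by Laguerre histories is onto. -/
theorem card_filter_stepList {n : ℕ} {code : Equiv.Perm (Fin n) → Fin n → Step}
    (hinj : Function.Injective code) (hmem : ∀ σ, stepList (code σ) ∈ histories n 0)
    (P : List Step → Prop) [DecidablePred P] :
    (univ.filter fun σ => P (stepList (code σ))).card = ((histories n 0).filter P).card := by
  have hinj' : Function.Injective fun σ => stepList (code σ) := stepList_injective.comp hinj
  have himage : univ.image (fun σ => stepList (code σ)) = histories n 0 := by
    -- The image has `n!` elements and lies in a set of at most `n!` elements.
    refine eq_of_subset_of_card_le (fun l hl => ?_) ?_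
    · obtain ⟨σ, -, rfl⟩ := mem_image.1 hl
      exact hmem σ
    · rw [card_image_of_injective _ hinj', card_univ, Fintype.card_perm, Fintype.card_fin]
      simpa using card_histories_le n 0
  rw [← himage, filter_image, card_image_of_injective _ hinj']

end Histories

/-! ### The code by crossings and nestings. -/

section CrossingCode

variable {n : ℕ}

/-- The Foata–Zeilberger code of a permutation: step `i` records whether `i` is a weak exceedance
position, whether it is a weak exceedance value, and its crossing and nesting numbers. -/
def crossingCode (σ : Equiv.Perm (Fin n)) (i : Fin n) : Step :=
  (decide (i ≤ σ i), decide (σ⁻¹ i ≤ i), (crossPlus σ i).card + (crossMinus σ i).card,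
    (nestPlus σ i).card + (nestMinus σ i).card)

/-- The number of arcs `j ↦ σ j` that pass weakly above `v` from before `v`. -/
def openArcs (σ : Equiv.Perm (Fin n)) (v : ℕ) : ℕ :=
  (univ.filter fun j : Fin n => (j : ℕ) < v ∧ v ≤ σ j).card

/-- As many positions as values lie below `v`; discard the `j` with both `j` and `σ j` below `v`. -/
theorem openArcs_eq (σ : Equiv.Perm (Fin n)) (v : ℕ) :
    openArcs σ v = (univ.filter fun j : Fin n => v ≤ (j : ℕ) ∧ (σ j : ℕ) < v).card := by
  have h1 := card_filter_eq_add (p := fun j : Fin n => (j : ℕ) < v)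
    (q := fun j => (j : ℕ) < v ∧ v ≤ σ j) (r := fun j => (j : ℕ) < v ∧ (σ j : ℕ) < v)
    (by intro j; omega) (by intro j; omega)
  have h2 := card_filter_eq_add (p := fun j : Fin n => (σ j : ℕ) < v)
    (q := fun j => v ≤ (j : ℕ) ∧ (σ j : ℕ) < v) (r := fun j => (j : ℕ) < v ∧ (σ j : ℕ) < v)
    (by intro j; omega) (by intro j; omega)
  have h3 : (univ.filter fun j : Fin n => (σ j : ℕ) < v).card =
      (univ.filter fun j : Fin n => (j : ℕ) < v).card :=
    card_equiv σ (by simp)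
  rw [openArcs]
  omega

/-- From the arcs with `j ≤ i ≤ σ j`, drop either the one starting at `i` or the one ending at `i`.
-/
theorem openArcs_step (σ : Equiv.Perm (Fin n)) (i : Fin n) :
    openArcs σ (i + 1) + (decide (σ⁻¹ i ≤ i)).toNat =
      openArcs σ i + (decide (i ≤ σ i)).toNat := by
  have h1 := card_filter_eq_add_ite (p := fun j : Fin n => j ≤ i ∧ i ≤ σ j)
    (q := fun j => (j : ℕ) < i ∧ (i : ℕ) ≤ σ j) (b := i ≤ σ i) i
    (by intro j hj; simp only [Fin.le_def, ne_eq, Fin.ext_iff] at *; omega) (by simp) (by simp)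
  have h2 := card_filter_eq_add_ite (p := fun j : Fin n => j ≤ i ∧ i ≤ σ j)
    (q := fun j => (j : ℕ) < i + 1 ∧ (i : ℕ) + 1 ≤ σ j) (b := σ⁻¹ i ≤ i) (σ⁻¹ i)
    (by
      intro j hj
      have hj' : σ j ≠ i := fun h => hj (by simp [← h])
      simp only [Fin.le_def, ne_eq, Fin.ext_iff] at *; omega) (by simp) (by simp)
  simp only [openArcs, Bool.toNat, Bool.cond_decide]
  omega

/-- At a weak exceedance, every open arc from the left crosses or nests with the arc of `i`.
Otherwise the same holds for the arcs back across `i`, except the arc of `i` itself, which accounts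
for the negated bit. -/
theorem crossingCode_label (σ : Equiv.Perm (Fin n)) (i : Fin n) :
    (crossingCode σ i).2.2.1 + (crossingCode σ i).2.2.2 + (!(crossingCode σ i).1).toNat =
      openArcs σ i := by
  have hne : ∀ j, j ≠ i → (σ j : ℕ) ≠ σ i := fun j hj h => hj (σ.injective (Fin.ext h))
  by_cases hi : i ≤ σ i
  · have h1 : crossMinus σ i = ∅ := filter_eq_empty_iff.2 fun j _ => by
      simp only [Fin.le_def, Fin.lt_def] at *; omega
    have h2 : nestMinus σ i = ∅ := filter_eq_empty_iff.2 fun j _ => by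
      simp only [Fin.le_def, Fin.lt_def] at *; omega
    have h3 := card_filter_eq_add (p := fun j : Fin n => (j : ℕ) < i ∧ (i : ℕ) ≤ σ j)
      (q := fun j => j < i ∧ i ≤ σ j ∧ σ j < σ i) (r := fun j => j < i ∧ i ≤ σ i ∧ σ i < σ j)
      (by
        intro j
        have := hne j
        simp only [Fin.le_def, Fin.lt_def, ne_eq, Fin.ext_iff] at *; omega)
      (by intro j; simp only [Fin.le_def, Fin.lt_def]; omega)
    simp only [crossingCode, h1, h2, hi, openArcs, crossPlus, nestPlus, card_empty,
      decide_true, Bool.not_true, Bool.toNat_false] at *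
    omega
  · have h1 : crossPlus σ i = ∅ := filter_eq_empty_iff.2 fun j _ => by
      simp only [Fin.le_def, Fin.lt_def] at *; omega
    have h2 : nestPlus σ i = ∅ := filter_eq_empty_iff.2 fun j _ => by
      simp only [Fin.le_def, Fin.lt_def] at *; omega
    have h3 := card_filter_eq_add (p := fun j : Fin n => i < j ∧ σ j < i)
      (q := fun j => i < j ∧ σ j < i ∧ σ i < σ j) (r := fun j => i < j ∧ σ i < i ∧ σ j < σ i)
      (by
        intro j
        have := hne j
        simp only [Fin.le_def, Fin.lt_def, ne_eq, Fin.ext_iff] at *; omega)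
      (by intro j; simp only [Fin.lt_def]; omega)
    have h4 := card_filter_eq_add_ite (p := fun j : Fin n => (i : ℕ) ≤ j ∧ (σ j : ℕ) < i)
      (q := fun j => i < j ∧ σ j < i) (b := True) i
      (by intro j hj; simp only [Fin.lt_def, ne_eq, Fin.ext_iff] at *; omega) (by simp)
      (by simpa using hi)
    simp only [crossingCode, h1, h2, hi, openArcs_eq, crossMinus, nestMinus, card_empty,
      decide_false, Bool.not_false, Bool.toNat_true, if_true] at *
    omega

theorem stepList_crossingCode_mem (σ : Equiv.Perm (Fin n)) :
    stepList (crossingCode σ) ∈ histories n 0 := by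
  refine stepList_mem_histories (ht := openArcs σ) ?_ ?_ (crossingCode_label σ) (openArcs_step σ)
  · simp [openArcs]
  · exact card_eq_zero.2 (filter_eq_empty_iff.2 fun j _ => by omega)

/-- A word is determined by its set of letters and its inversion code. -/
theorem eqOn_of_inversionCode {α β : Type*} [Fintype α] [LinearOrder α] [LinearOrder β]
    {f g : α → β} (hf : Function.Injective f) (hg : Function.Injective g) (s : Finset α)
    (himage : s.image f = s.image g)
    (hcode : ∀ j ∈ s, (s.filter fun i => i < j ∧ f j < f i).card =
      (s.filter fun i => i < j ∧ g j < g i).card) :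
    ∀ j ∈ s, f j = g j := by
  intro j
  induction j using WellFoundedGT.induction with
  | _ j ih =>
  intro hj
  -- Once the later values agree, the remaining values form a known set, and `f j` is found from the
  -- number of them above it.
  have hset : (s.filter (· ≤ j)).image f = (s.filter (· ≤ j)).image g := by
    have hgt : (s.filter (j < ·)).image f = (s.filter (j < ·)).image g :=
      image_congr fun i hi => by
        simp only [coe_filter, Set.mem_ofPred_eq] at hi; exact ih i hi.2 hi.1
    have hle : s.filter (· ≤ j) = s \ s.filter (j < ·) := by ext; simp; tauto
    rw [hle, image_sdiff _ _ hf, image_sdiff _ _ hg, himage, hgt]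
  have hcard : ∀ {k : α → β}, Function.Injective k →
      (s.filter fun i => i < j ∧ k j < k i).card =
        (((s.filter (· ≤ j)).image k).filter (k j < ·)).card := by
    intro k hk
    rw [filter_image, card_image_of_injective _ hk, filter_filter]
    congr 1
    refine filter_congr fun i _ => ⟨fun h => ⟨h.1.le, h.2⟩, fun h => ⟨lt_of_le_of_ne h.1 ?_, h.2⟩⟩
    rintro rfl
    exact lt_irrefl _ h.2
  have h := hcode j hj
  rw [hcard hf, hcard hg, hset] at h
  have hfj : f j ∈ (s.filter (· ≤ j)).image g :=
    hset ▸ mem_image_of_mem f (mem_filter.2 ⟨hj, le_rfl⟩)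
  have hgj : g j ∈ (s.filter (· ≤ j)).image g := mem_image_of_mem g (mem_filter.2 ⟨hj, le_rfl⟩)
  have aux : ∀ {T : Finset β} {x y : β}, y ∈ T → x < y →
      (T.filter (y < ·)).card < (T.filter (x < ·)).card := fun {T x y} hy hxy =>
    card_lt_card (ssubset_iff_of_subset
      (monotone_filter_right _ fun z _ hz => hxy.trans hz) |>.2 ⟨y, by simp [hy, hxy]⟩)
  rcases lt_trichotomy (f j) (g j) with hlt | heq | hlt
  · exact absurd h (aux hgj hlt).ne'
  · exact heq
  · exact absurd h (aux hfj hlt).ne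

/-- The bits give the positions and the values of the weak exceedances; the nesting numbers are the
inversion code of `σ` on these positions and on the complement. -/
theorem crossingCode_injective : Function.Injective (crossingCode (n := n)) := by
  intro σ τ h
  have hE : ∀ i, i ≤ σ i ↔ i ≤ τ i := fun i => by
    simpa [crossingCode] using congrArg (·.1) (congrFun h i)
  have hF : ∀ i, σ⁻¹ i ≤ i ↔ τ⁻¹ i ≤ i := fun i => by
    simpa [crossingCode] using congrArg (·.2.1) (congrFun h i)
  have hN : ∀ i, (nestPlus σ i).card + (nestMinus σ i).card =
      (nestPlus τ i).card + (nestMinus τ i).card := fun i => congrArg (·.2.2.2) (congrFun h i)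
  have hplus : ∀ (ρ : Equiv.Perm (Fin n)) i, i ≤ ρ i →
      (nestPlus ρ i).card + (nestMinus ρ i).card =
        ((univ.filter fun j => j ≤ ρ j).filter fun j => j < i ∧ ρ i < ρ j).card := by
    intro ρ i hi
    have h2 : nestMinus ρ i = ∅ := filter_eq_empty_iff.2 fun j _ => by
      simp only [Fin.le_def, Fin.lt_def] at *; omega
    rw [h2, card_empty, add_zero, nestPlus, filter_filter]
    congr 2; ext j
    simp only [Fin.le_def, Fin.lt_def] at *; omega
  have hminus : ∀ (ρ : Equiv.Perm (Fin n)) i, ¬ i ≤ ρ i →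
      (nestPlus ρ i).card + (nestMinus ρ i).card =
        ((univ.filter fun j => ¬ j ≤ ρ j).filter fun j => i < j ∧ ρ j < ρ i).card := by
    intro ρ i hi
    have h2 : nestPlus ρ i = ∅ := filter_eq_empty_iff.2 fun j _ => by
      simp only [Fin.le_def, Fin.lt_def] at *; omega
    rw [h2, card_empty, zero_add, nestMinus, filter_filter]
    congr 2; ext j
    simp only [Fin.le_def, Fin.lt_def] at *; omega
  have himage : ∀ (ρ : Equiv.Perm (Fin n)),
      (univ.filter fun j => j ≤ ρ j).image ρ = univ.filter fun j => ρ⁻¹ j ≤ j := by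
    intro ρ; ext j
    simp only [mem_image, mem_filter, mem_univ, true_and]
    exact ⟨by rintro ⟨i, hi, rfl⟩; simpa using hi, fun hj => ⟨ρ⁻¹ j, by simpa using hj, by simp⟩⟩
  have himage' : ∀ (ρ : Equiv.Perm (Fin n)),
      (univ.filter fun j => ¬ j ≤ ρ j).image ρ = univ.filter fun j => ¬ ρ⁻¹ j ≤ j := by
    intro ρ; ext j
    simp only [mem_image, mem_filter, mem_univ, true_and]
    exact ⟨by rintro ⟨i, hi, rfl⟩; simpa using hi, fun hj => ⟨ρ⁻¹ j, by simpa using hj, by simp⟩⟩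
  have hsE : (univ.filter fun j => j ≤ σ j) = univ.filter fun j => j ≤ τ j := by simp only [hE]
  have hsE' : (univ.filter fun j => ¬ j ≤ σ j) = univ.filter fun j => ¬ j ≤ τ j := by
    simp only [hE]
  ext i : 1
  by_cases hi : i ≤ σ i
  · refine eqOn_of_inversionCode σ.injective τ.injective (univ.filter fun j => j ≤ σ j) ?_ ?_ i
      (by simpa using hi)
    · rw [himage, hsE, himage]; simp only [hF]
    · intro j hj
      have hj : j ≤ σ j := by simpa using hj
      rw [← hplus σ j hj, hsE, ← hplus τ j ((hE j).1 hj), hN]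
  -- Off the weak exceedances, nestings are inversions for both orders reversed.
  · refine eqOn_of_inversionCode (α := (Fin n)ᵒᵈ) (β := (Fin n)ᵒᵈ) (f := σ) (g := τ)
      σ.injective τ.injective (univ.filter fun j : Fin n => ¬ j ≤ σ j) ?_ ?_ i
      (mem_filter.2 ⟨mem_univ _, hi⟩)
    · refine (himage' σ).trans (Eq.trans ?_ ((congrArg _ hsE').trans (himage' τ)).symm)
      simp only [hF]
    · intro j hj
      have hj : ¬ LE.le (α := Fin n) j (σ j) := (mem_filter.1 hj).2
      have h1 := hminus σ j hj
      have h2 := hminus τ j (mt (hE j).2 hj)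
      rw [← hsE'] at h2
      exact h1.symm.trans ((hN j).trans h2)

end CrossingCode

/-! ### The code by descents and the patterns `31-2` and `2-31`. -/

section PatternCode

variable {n : ℕ}

theorem perm_inv_apply_self (τ : Equiv.Perm (Fin n)) (i : Fin n) : τ⁻¹ (τ i) = i :=
  τ.symm_apply_apply i

/-- The letter after `v` in the word of `τ` exists and is smaller than `v`. -/
def SuccLT (τ : Equiv.Perm (Fin n)) (v : Fin n) : Prop :=
  ∃ h : (τ⁻¹ v : ℕ) + 1 < n, τ ⟨τ⁻¹ v + 1, h⟩ < v

/-- The letter before `b` in the word of `τ` exists and is at least `w`. -/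
def PredGE (τ : Equiv.Perm (Fin n)) (w : ℕ) (b : Fin n) : Prop :=
  ∃ i : Fin n, ∃ h : (i : ℕ) + 1 < n, τ ⟨i + 1, h⟩ = b ∧ w ≤ τ i

open Classical in
/-- The Françon–Viennot code of a permutation: step `v` records whether the next letter and the
previous letter are smaller than `v`, and the numbers of occurrences of `31-2` and of `2-31` in
which `v` plays the part of the `2`. -/
noncomputable def patternCode (τ : Equiv.Perm (Fin n)) (v : Fin n) : Step :=
  (!decide (SuccLT τ v), !decide (PredGE τ (v + 1) v),
    (univ.filter fun i : Fin n => i < τ⁻¹ v ∧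
      ∃ h : (i : ℕ) + 1 < n, v < τ i ∧ τ ⟨i + 1, h⟩ < v).card,
    (univ.filter fun i : Fin n => τ⁻¹ v < i ∧
      ∃ h : (i : ℕ) + 1 < n, τ ⟨i + 1, h⟩ < v ∧ v < τ i).card)

/-- The number of descents of `τ` from a value at least `v` to a value less than `v`. -/
def straddlingDescents (τ : Equiv.Perm (Fin n)) (v : ℕ) : ℕ :=
  (univ.filter fun i : Fin n => ∃ h : (i : ℕ) + 1 < n,
    (τ ⟨i + 1, h⟩ : ℕ) < v ∧ v ≤ τ i).card

theorem patternCode_label_sum (τ : Equiv.Perm (Fin n)) (v : Fin n) :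
    (univ.filter fun i : Fin n => ∃ h : (i : ℕ) + 1 < n, τ ⟨i + 1, h⟩ < v ∧ v < τ i).card =
      (patternCode τ v).2.2.1 + (patternCode τ v).2.2.2 := by
  refine card_filter_eq_add (fun i => ⟨?_, ?_⟩) ?_
  · rintro ⟨h, h1, h2⟩
    have hi : i ≠ τ⁻¹ v := by rintro rfl; simp at h2
    rcases lt_or_gt_of_ne hi with hi | hi
    · exact .inl ⟨hi, h, h2, h1⟩
    · exact .inr ⟨hi, h, h1, h2⟩
  · rintro (⟨-, h, h2, h1⟩ | ⟨-, h, h1, h2⟩) <;> exact ⟨h, h1, h2⟩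
  · rintro i ⟨h, -⟩ ⟨h', -⟩
    exact lt_asymm h h'

/-- A descent straddling `v` either has `v` strictly between its letters or has `v` as its top. -/
theorem patternCode_label (τ : Equiv.Perm (Fin n)) (v : Fin n) :
    (patternCode τ v).2.2.1 + (patternCode τ v).2.2.2 + (!(patternCode τ v).1).toNat =
      straddlingDescents τ v := by
  classical
  have h := card_filter_eq_add_ite
    (p := fun i : Fin n => ∃ h : (i : ℕ) + 1 < n, (τ ⟨i + 1, h⟩ : ℕ) < v ∧ (v : ℕ) ≤ τ i)
    (q := fun i : Fin n => ∃ h : (i : ℕ) + 1 < n, τ ⟨i + 1, h⟩ < v ∧ v < τ i)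
    (b := SuccLT τ v) (τ⁻¹ v) ?_ (by simp) (by simp [SuccLT])
  · rw [straddlingDescents, h, patternCode_label_sum]
    by_cases hv : SuccLT τ v <;> simp [patternCode, hv]
  · intro j hj
    have hj' : v ≠ τ j := by rintro rfl; simp at hj
    simp only [Fin.val_fin_lt, Fin.val_fin_le, hj'.le_iff_lt]

theorem straddlingDescents_step (τ : Equiv.Perm (Fin n)) (v : Fin n) :
    straddlingDescents τ (v + 1) + (patternCode τ v).2.1.toNat =
      straddlingDescents τ v + (patternCode τ v).1.toNat := by
  classical
  have h := card_filter_eq_add_ite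
    (p := fun i : Fin n => ∃ h : (i : ℕ) + 1 < n,
      (τ ⟨i + 1, h⟩ : ℕ) < v + 1 ∧ (v : ℕ) + 1 ≤ τ i)
    (q := fun i : Fin n => ∃ h : (i : ℕ) + 1 < n, τ ⟨i + 1, h⟩ < v ∧ v < τ i)
    -- The position before `v`, where a descent with bottom `v` would sit. If `v` comes first,
    -- truncation gives the position of `v`, where both predicates fail.
    (b := PredGE τ (v + 1) v) ⟨τ⁻¹ v - 1, by omega⟩ ?_ ?_ ?_
  · have h1 := patternCode_label τ v
    rw [← patternCode_label_sum] at h1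
    rw [straddlingDescents, h, ← h1]
    by_cases hE : SuccLT τ v <;> by_cases hF : PredGE τ (v + 1) v <;>
      simp [patternCode, hE, hF]
  · intro j hj
    refine exists_congr fun hj1 => ?_
    have hne : τ ⟨j + 1, hj1⟩ ≠ v := by
      rintro rfl
      simp at hj
    simp only [Fin.lt_def, ne_eq, Fin.ext_iff] at *
    omega
  · rintro ⟨h1, h2, h3⟩
    rcases Nat.eq_zero_or_pos (τ⁻¹ v : ℕ) with h0 | h0
    · have : (⟨τ⁻¹ v - 1, by omega⟩ : Fin n) = τ⁻¹ v :=
        Fin.ext (show (τ⁻¹ v : ℕ) - 1 = τ⁻¹ v by omega)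
      rw [this] at h3
      simp at h3
    · have : (⟨τ⁻¹ v - 1 + 1, h1⟩ : Fin n) = τ⁻¹ v :=
        Fin.ext (show (τ⁻¹ v : ℕ) - 1 + 1 = τ⁻¹ v by omega)
      simp only [this] at h2
      simp at h2
  · constructor
    · rintro ⟨h1, h2, h3⟩
      refine ⟨_, h1, ?_, h3⟩
      rcases Nat.eq_zero_or_pos (τ⁻¹ v : ℕ) with h0 | h0
      · have : (⟨τ⁻¹ v - 1, by omega⟩ : Fin n) = τ⁻¹ v :=
        Fin.ext (show (τ⁻¹ v : ℕ) - 1 = τ⁻¹ v by omega)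
        rw [this] at h3
        simp at h3
      · have : (⟨τ⁻¹ v - 1 + 1, h1⟩ : Fin n) = τ⁻¹ v :=
        Fin.ext (show (τ⁻¹ v : ℕ) - 1 + 1 = τ⁻¹ v by omega)
        exact (congrArg τ this).trans (τ.apply_symm_apply v)
    · rintro ⟨i, h1, h2, h3⟩
      have hi : (⟨τ⁻¹ v - 1, by omega⟩ : Fin n) = i := Fin.ext (by simp [← h2])
      rw [hi]
      exact ⟨h1, by rw [h2]; omega, h3⟩

theorem stepList_patternCode_mem (τ : Equiv.Perm (Fin n)) :
    stepList (patternCode τ) ∈ histories n 0 := by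
  refine stepList_mem_histories (ht := straddlingDescents τ) ?_ ?_ (patternCode_label τ)
    (straddlingDescents_step τ)
  · simp [straddlingDescents]
  · exact card_eq_zero.2 (filter_eq_empty_iff.2 fun j _ => by rintro ⟨_, _, h⟩; omega)

-- Each descent across `v` is replaced by its bottom letter. Cut by the letters `≥ v`, the word
-- leaves blocks of smaller letters, and these bottoms are the block starts preceded by a letter.
open Classical in
theorem patternCode_label_eq_card (τ : Equiv.Perm (Fin n)) (v : Fin n) :
    (patternCode τ v).2.2.1 =
      (univ.filter fun b : Fin n => b < v ∧ τ⁻¹ b < τ⁻¹ v ∧ PredGE τ v b).card := by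
  dsimp only [patternCode]
  refine card_bij (fun (i : Fin n) hi => τ ⟨i + 1, (mem_filter.1 hi).2.2.fst⟩) ?_ ?_ ?_
  · intro i hi
    obtain ⟨h, h1, h2, h3⟩ := (mem_filter.1 hi).2
    refine mem_filter.2 ⟨mem_univ _, h3, ?_, i, h1, rfl, h2.le⟩
    have hne : τ⁻¹ v ≠ ⟨i + 1, h1⟩ := by intro he; rw [← he] at h3; simp at h3
    simp only [perm_inv_apply_self, Fin.lt_def, ne_eq, Fin.ext_iff] at *
    omega
  · intro i hi j hj h
    simpa [Fin.ext_iff] using h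
  · intro b hb
    obtain ⟨h1, h2, i, h3, rfl, h4⟩ := (mem_filter.1 hb).2
    have hi : i < τ⁻¹ v := by
      simp only [perm_inv_apply_self, Fin.lt_def] at *
      omega
    refine ⟨i, mem_filter.2 ⟨mem_univ _, hi, h3, lt_of_le_of_ne h4 ?_, h1⟩, rfl⟩
    rintro rfl
    simp at hi

/-- Between a letter that is at least `v` and a later letter less than `v` there is a descent
across `v`. -/
theorem exists_predGE_between (τ : Equiv.Perm (Fin n)) {v : ℕ} {p q : Fin n} (hpq : p < q)
    (hp : v ≤ τ p) (hq : (τ q : ℕ) < v) :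
    ∃ b : Fin n, (b : ℕ) < v ∧ p < τ⁻¹ b ∧ τ⁻¹ b ≤ q ∧ PredGE τ v b := by
  classical
  -- The letter sought is the first one below `v` after position `p`.
  have hex : ∃ j : ℕ, (p : ℕ) < j ∧ ∃ h : j < n, (τ ⟨j, h⟩ : ℕ) < v := ⟨q, hpq, q.2, hq⟩
  obtain ⟨hlt, hn, hj⟩ := Nat.find_spec hex
  have hle : Nat.find hex ≤ q := Nat.find_min' hex ⟨hpq, q.2, hq⟩
  have hmin := fun m => Nat.find_min hex (m := m)
  generalize Nat.find hex = j at *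
  obtain ⟨i, rfl⟩ : ∃ i, j = i + 1 := ⟨j - 1, by omega⟩
  refine ⟨τ ⟨i + 1, hn⟩, hj, by simpa [Fin.lt_def] using hlt, by simpa [Fin.le_def] using hle,
    ⟨i, by omega⟩, hn, rfl, ?_⟩
  rcases Nat.lt_succ_iff_lt_or_eq.1 hlt with h | h
  · by_contra hc
    exact hmin i (by omega) ⟨h, by omega, by omega⟩
  · have : (⟨i, by omega⟩ : Fin n) = p := Fin.ext h.symm
    rwa [this]

-- The label counts the block starts left of `v`. If `v` precedes `a`, a further block starts
-- between them, so the count up to `a` exceeds the label.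
open Classical in
theorem inv_lt_inv_iff_card_le (τ : Equiv.Perm (Fin n)) {a v : Fin n} (hav : a < v) :
    τ⁻¹ a < τ⁻¹ v ↔
      (univ.filter fun b : Fin n => b < v ∧ τ⁻¹ b ≤ τ⁻¹ a ∧ PredGE τ v b).card ≤
        (patternCode τ v).2.2.1 := by
  rw [patternCode_label_eq_card]
  constructor
  · intro h
    exact card_le_card (monotone_filter_right _ fun b _ hb => ⟨hb.1, hb.2.1.trans_lt h, hb.2.2⟩)
  · intro h
    by_contra hlt
    have hne : τ⁻¹ v ≠ τ⁻¹ a := fun he => hav.ne' (τ⁻¹.injective he)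
    have hlt : τ⁻¹ v < τ⁻¹ a := lt_of_le_of_ne (not_lt.1 hlt) hne
    obtain ⟨b, hb1, hb2, hb3, hb4⟩ :=
      exists_predGE_between τ (v := v) hlt (by simp) (by simpa using hav)
    refine absurd h (not_le.2 (card_lt_card ?_))
    refine (ssubset_iff_of_subset (monotone_filter_right _ fun c _ hc =>
      ⟨hc.1, (hc.2.1.trans hlt).le, hc.2.2⟩)).2 ⟨b, ?_, ?_⟩
    · exact mem_filter.2 ⟨mem_univ _, hb1, hb3, hb4⟩
    · exact fun hb => lt_asymm hb2 (mem_filter.1 hb).2.2.1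

/-- Raising the threshold past `v` removes a block start `b` only if `v` immediately precedes it,
which is expressed here through `SuccLT` and the relative order of letters up to `v`. -/
theorem predGE_succ_iff (τ : Equiv.Perm (Fin n)) {b v : Fin n} (hbv : b < v) :
    PredGE τ (v + 1) b ↔ PredGE τ v b ∧
      ¬ (SuccLT τ v ∧ τ⁻¹ v < τ⁻¹ b ∧ ∀ c < v, τ⁻¹ v < τ⁻¹ c → ¬ τ⁻¹ c < τ⁻¹ b) := by
  constructor
  · rintro ⟨i, h, rfl, hi⟩
    refine ⟨⟨i, h, rfl, by omega⟩, ?_⟩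
    rintro ⟨⟨h1, h2⟩, h3, h4⟩
    have h5 := h4 _ h2 (by simp [Fin.lt_def])
    have hne : i ≠ τ⁻¹ v := by rintro rfl; simp at hi
    simp only [perm_inv_apply_self, Fin.lt_def, ne_eq, Fin.ext_iff] at *
    omega
  · rintro ⟨⟨i, h, rfl, hi⟩, hnot⟩
    refine ⟨i, h, rfl, lt_of_le_of_ne hi fun he => hnot ?_⟩
    obtain rfl : v = τ i := Fin.ext he
    refine ⟨⟨by simpa using h, by simpa using hbv⟩, by simp [Fin.lt_def], fun c _ h1 h2 => ?_⟩
    simp only [perm_inv_apply_self, Fin.lt_def] at h1 h2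
    omega

/-- The word is rebuilt by inserting the letters in increasing order. The induction carries the
relative order of the letters below `v` together with the block starts: the `31-2` label places `v`,
and the two bits update the block starts. -/
theorem patternCode_injective : Function.Injective (patternCode (n := n)) := by
  classical
  intro σ τ h
  have hE : ∀ v, SuccLT σ v ↔ SuccLT τ v := fun v => by
    simpa [patternCode] using congrArg (·.1) (congrFun h v)
  have hF : ∀ v : Fin n, PredGE σ (v + 1) v ↔ PredGE τ (v + 1) v := fun v : Fin n => by
    simpa [patternCode] using congrArg (·.2.1) (congrFun h v)
  have hL : ∀ v, (patternCode σ v).2.2.1 = (patternCode τ v).2.2.1 := fun v => by rw [h]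
  have main : ∀ v ≤ n,
      (∀ a b : Fin n, (a : ℕ) < v → (b : ℕ) < v → (σ⁻¹ a < σ⁻¹ b ↔ τ⁻¹ a < τ⁻¹ b)) ∧
        ∀ b : Fin n, (b : ℕ) < v → (PredGE σ v b ↔ PredGE τ v b) := by
    intro v
    induction v with
    | zero => simp
    | succ v ih =>
      intro hv
      obtain ⟨ih1, ih2⟩ := ih (by omega)
      obtain ⟨w, rfl⟩ : ∃ w : Fin n, (w : ℕ) = v := ⟨⟨v, hv⟩, rfl⟩
      have hleft : ∀ a : Fin n, a < w → (σ⁻¹ a < σ⁻¹ w ↔ τ⁻¹ a < τ⁻¹ w) := by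
        intro a ha
        rw [inv_lt_inv_iff_card_le σ ha, inv_lt_inv_iff_card_le τ ha, hL]
        have : (univ.filter fun b : Fin n => b < w ∧ σ⁻¹ b ≤ σ⁻¹ a ∧ PredGE σ w b) =
            univ.filter fun b : Fin n => b < w ∧ τ⁻¹ b ≤ τ⁻¹ a ∧ PredGE τ w b :=
          filter_congr fun b _ => and_congr_right fun hb => by
            rw [ih2 b hb, ← not_lt, ih1 a b ha hb, not_lt]
        rw [this]
      have hright : ∀ a : Fin n, a < w → (σ⁻¹ w < σ⁻¹ a ↔ τ⁻¹ w < τ⁻¹ a) := by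
        intro a ha
        have hs : σ⁻¹ a ≠ σ⁻¹ w := fun he => ha.ne (σ⁻¹.injective he)
        have ht : τ⁻¹ a ≠ τ⁻¹ w := fun he => ha.ne (τ⁻¹.injective he)
        have := hleft a ha
        rw [← hs.le_iff_lt, ← ht.le_iff_lt] at this
        rw [← not_le, this, not_le]
      have hcases : ∀ a : Fin n, (a : ℕ) < w + 1 → a < w ∨ a = w := fun a ha =>
        (Nat.lt_succ_iff_lt_or_eq.1 ha).imp id Fin.ext
      refine ⟨fun a b ha hb => ?_, fun b hb => ?_⟩
      · rcases hcases a ha with ha | rfl <;> rcases hcases b hb with hb | rfl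
        · exact ih1 a b ha hb
        · exact hleft a ha
        · exact hright b hb
        · simp
      · rcases hcases b hb with hb | rfl
        · rw [predGE_succ_iff σ hb, predGE_succ_iff τ hb, ih2 b hb, hE, hright b hb]
          refine and_congr_right fun _ => not_congr <| and_congr_right fun _ =>
            and_congr_right fun _ => forall₂_congr fun c hc => ?_
          rw [hright c hc, ih1 c b hc hb]
        · exact hF b
  have hpos : ∀ (ρ : Equiv.Perm (Fin n)) (a : Fin n),
      (univ.filter fun b => ρ⁻¹ b < ρ⁻¹ a).card = (ρ⁻¹ a : ℕ) := by
    intro ρ a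
    rw [← Fin.card_Iio (ρ⁻¹ a)]
    exact card_equiv ρ⁻¹ (by simp)
  refine inv_injective (Equiv.ext fun a => Fin.ext ?_)
  rw [← hpos σ a, ← hpos τ a]
  simp only [(main n le_rfl).1 _ a (Fin.is_lt _) (Fin.is_lt _)]

end PatternCode

/-! ### Reading the statistics off the codes. -/

section Statistics

variable {n : ℕ} (σ : Equiv.Perm (Fin n))

theorem sum_crossingCode_weakExceedances :
    ((stepList (crossingCode σ)).map (·.1.toNat)).sum = weakExceedances σ := by
  rw [sum_map_stepList, weakExceedances, card_filter]
  simp [crossingCode, Bool.toNat, Bool.cond_decide]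

theorem sum_crossingCode_crossings :
    ((stepList (crossingCode σ)).map (·.2.2.1)).sum = crossings σ := by
  rw [sum_map_stepList, crossings, ← sum_add_distrib]
  rfl

theorem sum_crossingCode_nestings :
    ((stepList (crossingCode σ)).map (·.2.2.2)).sum = nestings σ := by
  rw [sum_map_stepList, nestings, ← sum_add_distrib]
  rfl

theorem sum_patternCode_descents :
    ((stepList (patternCode σ)).map (·.1.toNat)).sum + descents σ = n := by
  classical
  have h1 : descents σ = (univ.filter fun v => SuccLT σ v).card :=
    card_equiv σ (by simp [SuccLT])
  have h2 : ((stepList (patternCode σ)).map (·.1.toNat)).sum =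
      (univ.filter fun v => ¬ SuccLT σ v).card := by
    rw [sum_map_stepList, card_filter]
    refine sum_congr rfl fun v _ => ?_
    by_cases hv : SuccLT σ v <;> simp [patternCode, hv]
  rw [h1, h2, add_comm, card_filter_add_card_filter_not, card_univ, Fintype.card_fin]

theorem sum_patternCode_occ31_2 :
    ((stepList (patternCode σ)).map (·.2.2.1)).sum = occ31_2 σ := by
  rw [sum_map_stepList, occ31_2, card_filter, Fintype.sum_prod_type_right, ← Equiv.sum_comp σ]
  refine sum_congr rfl fun j _ => ?_
  rw [← card_filter]
  simp [patternCode]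

theorem sum_patternCode_occ2_31 :
    ((stepList (patternCode σ)).map (·.2.2.2)).sum = occ2_31 σ := by
  rw [sum_map_stepList, occ2_31, card_filter, Fintype.sum_prod_type, ← Equiv.sum_comp σ]
  refine sum_congr rfl fun j _ => ?_
  rw [← card_filter]
  simp [patternCode]

end Statistics

end PermStat

open PermStat in
theorem theorem1 (n k ℓ m : ℕ) :
    (Finset.univ.filter fun σ : Equiv.Perm (Fin n) =>
      PermStat.weakExceedances σ = k ∧ PermStat.crossings σ = ℓ ∧
        PermStat.nestings σ = m).card =
    (Finset.univ.filter fun σ : Equiv.Perm (Fin n) =>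
      (PermStat.descents σ : ℤ) = (n : ℤ) - (k : ℤ) ∧ PermStat.occ31_2 σ = ℓ ∧
        PermStat.occ2_31 σ = m).card := by
  let P : List Step → Prop := fun l => (l.map (·.1.toNat)).sum = k ∧
    (l.map (·.2.2.1)).sum = ℓ ∧ (l.map (·.2.2.2)).sum = m
  have h1 := card_filter_stepList (crossingCode_injective (n := n)) stepList_crossingCode_mem P
  have h2 := card_filter_stepList (patternCode_injective (n := n)) stepList_patternCode_mem P
  simp only [P, sum_crossingCode_weakExceedances, sum_crossingCode_crossings,
    sum_crossingCode_nestings] at h1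
  simp only [P, sum_patternCode_occ31_2, sum_patternCode_occ2_31] at h2
  rw [h1, ← h2]
  congr 1
  refine Finset.filter_congr fun σ _ => and_congr_left fun _ => ?_
  -- With subtraction in `ℤ`, `descents σ = n - k` says that the first bits sum to `k`, even for `k
  -- > n`.
  have := sum_patternCode_descents σ
  omega
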